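/- For an even positive integer $n$ and a skew-symmetric matrix $A=(A_{i,j})_{0\le i,j\le n-1}$, let $$\operatorname{Pf} A=\sum_{\pi}(-1)^{\mathrm{cr}(\pi)}\prod_{\substack{i<j\\ i,j\text{ matched in }\pi}}A_{i,j},$$ where $\pi$ runs over all perfect matchings of $\{0,1,\dots,n-1\}$ and $\mathrm{cr}(\pi)$ is the number of quadruples $i<j<k<l$ such that $\pi$ pairs $i$ with $k$ and $j$ with $l$. Let $b$ be a real number and $n$ a positive even integer such that $b+i+j\notin\{0,-1,-2,\dots\}$ for all $0\le i<j\le n-1$ (that is, $b$ is not a negative integer). Then $$\operatorname*{Pf}_{0\le i,j\le n-1}\big((j-i)\,\Gamma(b+i+j)\big)=\prod_{i=0}^{n/2-1}(2i+1)!\,\Gamma(b+2i+1),$$ where the diagonal entries of the matrix (which do not enter the Pfaffian) are $0$. -/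

import Mathlib

/-- The perfect matchings of (the complete graph on) a finite set `ι`. A matching is encoded by the
map that sends every vertex to its partner, that is, by a fixed-point-free involution of `ι`. -/
def perfectMatchings (ι : Type*) [Fintype ι] [DecidableEq ι] : Finset (Equiv.Perm ι) :=
  {π : Equiv.Perm ι | ∀ i, π i ≠ i ∧ π (π i) = i}

/-- The number of crossings of a matching `π` of a linearly ordered set: the number of quadruples
`i < j < k < l` such that `i` is paired with `k = π i` and `j` is paired with `l = π j`
(such a quadruple is determined by `i` and `j`). -/
def crossingNumber {ι : Type*} [Fintype ι] [LinearOrder ι] (π : Equiv.Perm ι) : ℕ :=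
  ({p : ι × ι | p.1 < p.2 ∧ p.2 < π p.1 ∧ π p.1 < π p.2} : Finset (ι × ι)).card

/-- The Pfaffian of a (skew-symmetric) matrix `A` whose rows and columns are indexed by a finite
linearly ordered set: the sum over all perfect matchings `π` of `(-1) ^ cr(π)` times the product of
the entries `A i j` over all pairs `i < j` that are matched in `π`. -/
def pfaffian {ι R : Type*} [Fintype ι] [LinearOrder ι] [CommRing R] (A : Matrix ι ι R) : R :=
  ∑ π ∈ perfectMatchings ι, (-1) ^ crossingNumber π * ∏ i : ι with i < π i, A i (π i)

/-!
For `b > 0` the matrix `(j - i) Γ(b + i + j)` is the Gram matrix, in the basis of monomials, of the skew form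
`⟨p, q⟩ = ∫ (p q' - p' q) x ^ b e ^ (-x) dx` on `(0, ∞)`. The monic Laguerre polynomial of degree
`N = n - 1` with parameter `b - 1` is skew-orthogonal to all monomials of degree less than `N - 1`,
and its value against `x ^ (N - 1)` is `N! Γ(b + N)`. No integral is needed to see this: in
coordinates it says that an alternating binomial sum, the `N`-th finite difference of a polynomial
of degree `i + 1`, vanishes for `i + 1 < N` and is `N!` for `i + 1 = N`
(`sum_monicLaguerre_mul_Gamma`); this makes sense for every `b` that is not a negative integer.

Hence adding a combination of the other columns to the last column leaves in it, above its last
place, only the entry `N! Γ(b + N)` in row `n - 2`. The Pfaffian is therefore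
`N! Γ(b + N)` times the Pfaffian of size `n - 2` with the same `b`
(`pfaffian_eq_mul_of_sum_col_eq`), and the product formula follows by induction.

That such a column operation, done simultaneously on the rows, preserves the Pfaffian follows from
two facts about the sum over matchings. It is linear in the last column, as each matching has one
arc at the last point. It vanishes if two rows agree, since it changes sign under the exchange of
two indices; for neighbouring indices this is because conjugating a matching by the exchange
creates or destroys exactly one crossing, unless the two indices are matched with each other, when
it replaces one entry by its negative (`exists_crossing_swap_iff`,
`pfaffian_submatrix_swap_of_covBy`).
-/

/-! ### The Pfaffian is alternating -/

theorem mem_perfectMatchings {ι : Type*} [Fintype ι] [DecidableEq ι] {π : Equiv.Perm ι} :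
    π ∈ perfectMatchings ι ↔ ∀ i, π i ≠ i ∧ π (π i) = i := by
  simp [perfectMatchings]

section CovBy

variable {ι : Type*} [LinearOrder ι] {a b : ι}

theorem swap_lt_swap_iff_of_covBy (hab : a ⋖ b) {x y : ι} (h₁ : ¬(x = a ∧ y = b))
    (h₂ : ¬(x = b ∧ y = a)) :
    Equiv.swap a b x < Equiv.swap a b y ↔ x < y := by
  have hlt := hab.lt
  have hle : ∀ z, a < z → b ≤ z := fun z hz => hab.ge_of_gt hz
  have hle' : ∀ z, z < b → z ≤ a := fun z hz => hab.le_of_lt hz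
  simp only [Equiv.swap_apply_def]
  have := hle x; have := hle y; have := hle' x; have := hle' y
  split_ifs <;> grind

/-- Conjugating a matching `π` by the transposition of two neighbours `a ⋖ b` that are not matched
with each other toggles exactly one crossing: after transport along the transposition, the
crossings of the two matchings agree except at a single pair `d`, which comes from the two arcs
through `a` and `b`. -/
theorem exists_crossing_swap_iff (hab : a ⋖ b) {π : Equiv.Perm ι}
    (hπ : ∀ i, π i ≠ i ∧ π (π i) = i) (hne : π a ≠ b) :
    ∃ d : ι × ι, ∀ p : ι × ι,
      ((Equiv.swap a b p.1 < Equiv.swap a b p.2 ∧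
        Equiv.swap a b p.2 < Equiv.swap a b (π p.1) ∧
        Equiv.swap a b (π p.1) < Equiv.swap a b (π p.2)) ↔
      ((p.1 < p.2 ∧ p.2 < π p.1 ∧ π p.1 < π p.2) ↔ p ≠ d)) := by
  have hlt := hab.lt
  have hle : ∀ z, a < z → b ≤ z := fun z hz => hab.ge_of_gt hz
  have key := fun x y => @swap_lt_swap_iff_of_covBy ι _ a b hab x y
  have ha := hπ a
  have hb := hπ b
  have hbne : π b ≠ a := by rintro h; apply hne; rw [← h]; exact hb.2
  have hinj : ∀ x y, π x = π y → x = y := fun x y h => π.injective h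
  have hpq : π a ≠ π b := fun h => hlt.ne (hinj _ _ h)
  have sa := Equiv.swap_apply_left a b
  have sb := Equiv.swap_apply_right a b
  have sp : Equiv.swap a b (π a) = π a := Equiv.swap_apply_of_ne_of_ne ha.1 hne
  have sq : Equiv.swap a b (π b) = π b := Equiv.swap_apply_of_ne_of_ne hbne hb.1
  have hlp := hle (π a)
  have hlq := hle (π b)
  -- Only the six pairs below are affected: in each of them `a` and `b` meet in a comparison.
  suffices H : ∃ d : ι × ι, (d = (a, b) ∨ d = (b, a) ∨ d = (π b, a) ∨ d = (π a, b) ∨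
      d = (π a, π b) ∨ d = (π b, π a)) ∧
      ∀ x y, (x = a ∧ y = b ∨ x = b ∧ y = a ∨ x = π b ∧ y = a ∨ x = π a ∧ y = b ∨
        x = π a ∧ y = π b ∨ x = π b ∧ y = π a) →
      ((Equiv.swap a b x < Equiv.swap a b y ∧
        Equiv.swap a b y < Equiv.swap a b (π x) ∧
        Equiv.swap a b (π x) < Equiv.swap a b (π y)) ↔
      ((x < y ∧ y < π x ∧ π x < π y) ↔ (x, y) ≠ d)) by
    obtain ⟨d, hd', hd⟩ := H
    refine ⟨d, ?_⟩
    rintro ⟨x, y⟩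
    by_cases hxy : x = a ∧ y = b ∨ x = b ∧ y = a ∨ x = π b ∧ y = a ∨ x = π a ∧ y = b ∨
        x = π a ∧ y = π b ∨ x = π b ∧ y = π a
    · exact hd x y hxy
    · have hx := (hπ x).2
      have hy := (hπ y).2
      rw [key x y (by tauto) (by tauto), key y (π x) (by grind) (by grind),
        key (π x) (π y) (by grind) (by grind)]
      have hne : (x, y) ≠ d := by
        rintro rfl
        exact hxy (by simpa using hd')
      simp [hne]
  clear key hπ hinj hle
  -- The partners of `a` and `b` lie outside `[a, b]`; their order relative to `a`, `b` and each other
  -- determines the toggled pair.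
  rcases lt_or_gt_of_ne ha.1 with h1 | h1 <;> rcases lt_or_gt_of_ne hbne with h2 | h2
  · rcases lt_or_gt_of_ne hpq with h | h
    on_goal 1 => refine ⟨(π a, π b), by simp, ?_⟩
    on_goal 2 => refine ⟨(π b, π a), by simp, ?_⟩
    all_goals
      rintro x y (⟨rfl, rfl⟩ | ⟨rfl, rfl⟩ | ⟨rfl, rfl⟩ | ⟨rfl, rfl⟩ | ⟨rfl, rfl⟩ | ⟨rfl, rfl⟩) <;>
      simp only [sa, sb, sp, sq, ha.2, hb.2, Prod.mk.injEq, ne_eq] <;> grind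
  · refine ⟨(π a, b), by simp, ?_⟩
    rintro x y (⟨rfl, rfl⟩ | ⟨rfl, rfl⟩ | ⟨rfl, rfl⟩ | ⟨rfl, rfl⟩ | ⟨rfl, rfl⟩ | ⟨rfl, rfl⟩) <;>
    simp only [sa, sb, sp, sq, ha.2, hb.2, Prod.mk.injEq, ne_eq] <;> grind
  · refine ⟨(π b, a), by simp, ?_⟩
    rintro x y (⟨rfl, rfl⟩ | ⟨rfl, rfl⟩ | ⟨rfl, rfl⟩ | ⟨rfl, rfl⟩ | ⟨rfl, rfl⟩ | ⟨rfl, rfl⟩) <;>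
    simp only [sa, sb, sp, sq, ha.2, hb.2, Prod.mk.injEq, ne_eq] <;> grind
  · rcases lt_or_gt_of_ne hpq with h | h
    on_goal 1 => refine ⟨(a, b), by simp, ?_⟩
    on_goal 2 => refine ⟨(b, a), by simp, ?_⟩
    all_goals
      rintro x y (⟨rfl, rfl⟩ | ⟨rfl, rfl⟩ | ⟨rfl, rfl⟩ | ⟨rfl, rfl⟩ | ⟨rfl, rfl⟩ | ⟨rfl, rfl⟩) <;>
      simp only [sa, sb, sp, sq, ha.2, hb.2, Prod.mk.injEq, ne_eq] <;> grind

/-- Two finite sets that differ in exactly one element `d` have cardinalities of opposite parity. -/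
theorem neg_one_pow_card_filter_eq_neg {α R : Type*} [Fintype α] [CommRing R] (P Q : α → Prop)
    [DecidablePred P] [DecidablePred Q] (d : α) (h : ∀ p, Q p ↔ (P p ↔ p ≠ d)) :
    (-1 : R) ^ (Finset.univ.filter Q).card = -(-1) ^ (Finset.univ.filter P).card := by
  classical
  by_cases hd : P d
  · have : Finset.univ.filter P = insert d (Finset.univ.filter Q) := by
      ext p
      simp only [Finset.mem_filter_univ, Finset.mem_insert, h]
      by_cases hp : p = d
      · subst hp; simp [hd]
      · simp [hp]
    rw [this, Finset.card_insert_of_notMem (by simp [h, hd]), pow_succ]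
    simp
  · have : Finset.univ.filter Q = insert d (Finset.univ.filter P) := by
      ext p
      simp only [Finset.mem_filter_univ, Finset.mem_insert, h]
      by_cases hp : p = d
      · subst hp; simp [hd]
      · simp [hp]
    rw [this, Finset.card_insert_of_notMem (by simp [hd]), pow_succ]
    simp

theorem neg_one_pow_crossingNumber_swap_conj {R : Type*} [CommRing R] [Fintype ι] (hab : a ⋖ b)
    {π : Equiv.Perm ι} (hπ : π ∈ perfectMatchings ι) (hne : π a ≠ b) :
    (-1 : R) ^ crossingNumber (Equiv.swap a b * π * Equiv.swap a b) =
      -(-1) ^ crossingNumber π := by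
  obtain ⟨d, hd⟩ := exists_crossing_swap_iff hab (mem_perfectMatchings.1 hπ) hne
  rw [crossingNumber, crossingNumber, ← neg_one_pow_card_filter_eq_neg _ _ d hd]
  congr 1
  refine Finset.card_equiv ((Equiv.swap a b).prodCongr (Equiv.swap a b)) ?_
  rintro ⟨x, y⟩
  rw [Finset.mem_filter_univ, Finset.mem_filter_univ]
  simp

theorem swap_conj_mem_perfectMatchings [Fintype ι] {π : Equiv.Perm ι}
    (hπ : π ∈ perfectMatchings ι) (a b : ι) :
    Equiv.swap a b * π * Equiv.swap a b ∈ perfectMatchings ι := by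
  rw [mem_perfectMatchings] at hπ ⊢
  intro i
  constructor
  · intro h
    apply (hπ (Equiv.swap a b i)).1
    have := congrArg (Equiv.swap a b) h
    simpa using this
  · simp [(hπ _).2]

theorem pfaffian_submatrix_swap_of_covBy {R : Type*} [CommRing R] [Fintype ι] (hab : a ⋖ b)
    {A : Matrix ι ι R} (hA : ∀ i j, A j i = -A i j) :
    pfaffian (A.submatrix (Equiv.swap a b) (Equiv.swap a b)) = -pfaffian A := by
  simp only [pfaffian, ← Finset.sum_neg_distrib]
  refine Finset.sum_nbij' (fun π => Equiv.swap a b * π * Equiv.swap a b)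
    (fun π => Equiv.swap a b * π * Equiv.swap a b)
    (fun π hπ => swap_conj_mem_perfectMatchings hπ a b)
    (fun π hπ => swap_conj_mem_perfectMatchings hπ a b)
    (fun π _ => by ext; simp) (fun π _ => by ext; simp) fun π hπ => ?_
  have hπ' := mem_perfectMatchings.1 hπ
  by_cases hne : π a = b
  -- The matching is fixed, and the sign comes from the entry `A a b` turning into `A b a`.
  · have hb : π b = a := by rw [← hne]; exact (hπ' a).2
    have hconj : Equiv.swap a b * π * Equiv.swap a b = π := by
      ext i
      rcases eq_or_ne i a with rfl | hia
      · simp [hne, hb]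
      rcases eq_or_ne i b with rfl | hib
      · simp [hne, hb]
      have h₁ : π i ≠ a := fun h => hib (by rw [← hne, ← h, (hπ' i).2])
      have h₂ : π i ≠ b := fun h => hia (by rw [← hb, ← h, (hπ' i).2])
      simp [Equiv.swap_apply_of_ne_of_ne, *]
    have hmem : a ∈ Finset.univ.filter fun i => i < π i := by simp [hne, hab.lt]
    rw [hconj, ← mul_neg, ← Finset.mul_prod_erase _ _ hmem, ← Finset.mul_prod_erase _ _ hmem,
      ← neg_mul]
    congr 2
    · simp [hne, hA a b]
    · refine Finset.prod_congr rfl fun i hi => ?_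
      simp only [Finset.mem_erase, Finset.mem_filter_univ] at hi
      have hib : i ≠ b := by
        rintro rfl
        exact (hb ▸ hi.2).not_gt hab.lt
      have h₁ : π i ≠ a := fun h => hib (by rw [← hne, ← h, (hπ' i).2])
      have h₂ : π i ≠ b := fun h => hi.1 (by rw [← hb, ← h, (hπ' i).2])
      simp only [Matrix.submatrix_apply, Equiv.swap_apply_of_ne_of_ne hi.1 hib,
        Equiv.swap_apply_of_ne_of_ne h₁ h₂]
  -- The product of entries is unchanged, and the sign comes from the crossing number.
  · rw [neg_one_pow_crossingNumber_swap_conj hab hπ hne, neg_mul, neg_neg]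
    congr 1
    refine Finset.prod_nbij' (Equiv.swap a b) (Equiv.swap a b) ?_ ?_ (by simp) (by simp) (by simp)
    all_goals
      intro i hi
      rw [Finset.mem_filter_univ] at hi ⊢
      simp only [Equiv.Perm.mul_apply, Equiv.swap_apply_self] at hi ⊢
    · rwa [swap_lt_swap_iff_of_covBy hab (by grind) (by grind)]
    · rw [← swap_lt_swap_iff_of_covBy hab (by grind) (by grind)]
      simpa using hi

end CovBy

/-- The Pfaffian is alternating under simultaneous permutation of rows and columns. The neighbouring
transpositions, which generate the symmetric group, suffice. -/
theorem pfaffian_submatrix_perm {n : ℕ} {R : Type*} [CommRing R] (σ : Equiv.Perm (Fin n))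
    {A : Matrix (Fin n) (Fin n) R} (hA : ∀ i j, A j i = -A i j) :
    pfaffian (A.submatrix σ σ) = (Equiv.Perm.sign σ : ℤ) * pfaffian A := by
  cases n with
  | zero => simp [Subsingleton.elim σ 1]
  | succ n =>
    have hσ : σ ∈ Submonoid.closure
        (Set.range fun i : Fin n => Equiv.swap i.castSucc i.succ) := by
      rw [Equiv.Perm.mclosure_swap_castSucc_succ]; trivial
    induction hσ using Submonoid.closure_induction generalizing A with
    | mem σ hσ =>
      obtain ⟨i, rfl⟩ := hσ
      rw [pfaffian_submatrix_swap_of_covBy (Fin.covBy_iff.2 (by simp)) hA,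
        Equiv.Perm.sign_swap (Fin.castSucc_lt_succ).ne]
      simp
    | one => simp
    | mul σ τ _ _ h₁ h₂ =>
      have := h₂ (A := A.submatrix σ σ) (fun i j => hA _ _)
      rw [h₁ hA] at this
      simp only [Matrix.submatrix_submatrix] at this
      rw [Equiv.Perm.coe_mul, this, Equiv.Perm.sign_mul]
      push_cast
      ring

theorem pfaffian_eq_zero_of_row_eq {n : ℕ} {A : Matrix (Fin n) (Fin n) ℝ}
    (hA : ∀ i j, A j i = -A i j) {k l : Fin n} (hkl : k ≠ l) (h : ∀ i, A k i = A l i) :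
    pfaffian A = 0 := by
  have hs : A.submatrix (Equiv.swap k l) (Equiv.swap k l) = A := by
    have h₁ : ∀ i j, A (Equiv.swap k l i) j = A i j := by
      intro i j
      rcases eq_or_ne i k with rfl | hik
      · simp [h]
      rcases eq_or_ne i l with rfl | hil
      · simp [h]
      rw [Equiv.swap_apply_of_ne_of_ne hik hil]
    ext i j
    rw [Matrix.submatrix_apply, h₁, hA, h₁, ← hA]
  have := pfaffian_submatrix_perm (Equiv.swap k l) hA
  rw [hs, Equiv.Perm.sign_swap hkl] at this
  push_cast at this
  linarith

/-! ### Elimination in the last column -/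

/-- The matrix `B` bordered by a last column `v`, a last row `-v` and a zero in the corner. -/
def skewBorder {N : ℕ} {R : Type*} [CommRing R] (B : Matrix (Fin N) (Fin N) R) (v : Fin N → R) :
    Matrix (Fin (N + 1)) (Fin (N + 1)) R :=
  Matrix.of fun i j =>
    Fin.lastCases (Fin.lastCases 0 (fun j => -v j) j) (fun i => Fin.lastCases (v i) (B i) j) i

section skewBorder

variable {N : ℕ} {R : Type*} [CommRing R] (B : Matrix (Fin N) (Fin N) R) (v : Fin N → R)

@[simp]
theorem skewBorder_castSucc_castSucc (i j : Fin N) :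
    skewBorder B v i.castSucc j.castSucc = B i j := by simp [skewBorder]

@[simp]
theorem skewBorder_castSucc_last (i : Fin N) :
    skewBorder B v i.castSucc (Fin.last N) = v i := by simp [skewBorder]

@[simp]
theorem skewBorder_last_castSucc (j : Fin N) :
    skewBorder B v (Fin.last N) j.castSucc = -v j := by simp [skewBorder]

@[simp]
theorem skewBorder_last_last : skewBorder B v (Fin.last N) (Fin.last N) = 0 := by
  simp [skewBorder]

theorem skewBorder_skew {B : Matrix (Fin N) (Fin N) R} (hB : ∀ i j, B j i = -B i j)
    (v : Fin N → R) (i j : Fin (N + 1)) : skewBorder B v j i = -skewBorder B v i j := by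
  induction i using Fin.lastCases <;> induction j using Fin.lastCases <;> simp
  exact hB _ _

/-- Each term of the Pfaffian contains exactly one entry of the border, and in the last column, so it
depends linearly on `v`. -/
theorem exists_prod_skewBorder_eq {π : Equiv.Perm (Fin (N + 1))}
    (hπ : π ∈ perfectMatchings (Fin (N + 1))) :
    ∃ k C, ∀ v, ∏ i with i < π i, skewBorder B v i (π i) = v k * C := by
  rw [mem_perfectMatchings] at hπ
  obtain ⟨k, hk⟩ := Fin.exists_castSucc_eq.2 (hπ (Fin.last N)).1
  have hk' : π k.castSucc = Fin.last N := by rw [hk]; exact (hπ _).2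
  refine ⟨k, ∏ i ∈ (Finset.univ.filter fun i => i < π i).erase k.castSucc,
    skewBorder B 0 i (π i), fun v => ?_⟩
  have hmem : k.castSucc ∈ Finset.univ.filter fun i => i < π i := by
    simp [hk', Fin.castSucc_lt_last]
  rw [← Finset.mul_prod_erase _ _ hmem, hk', skewBorder_castSucc_last]
  congr 1
  refine Finset.prod_congr rfl fun i hi => ?_
  rw [Finset.mem_erase, Finset.mem_filter_univ] at hi
  have h₁ : i ≠ Fin.last N := (hi.2.trans_le (Fin.le_last _)).ne
  have h₂ : π i ≠ Fin.last N := fun h => hi.1 (π.injective (h.trans hk'.symm))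
  obtain ⟨x, rfl⟩ := Fin.exists_castSucc_eq.2 h₁
  obtain ⟨y, hy⟩ := Fin.exists_castSucc_eq.2 h₂
  rw [← hy]
  simp

theorem isLinearMap_pfaffian_skewBorder :
    IsLinearMap R fun v => pfaffian (skewBorder B v) := by
  have key : ∀ π ∈ perfectMatchings (Fin (N + 1)),
      IsLinearMap R fun v => (-1) ^ crossingNumber π *
        ∏ i with i < π i, skewBorder B v i (π i) := by
    intro π hπ
    obtain ⟨k, C, h⟩ := exists_prod_skewBorder_eq B hπ
    constructor
    · intro v w
      simp only [h, Pi.add_apply]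
      ring
    · intro c v
      simp only [h, Pi.smul_apply, smul_eq_mul]
      ring
  constructor
  · intro v w
    simp only [pfaffian, ← Finset.sum_add_distrib]
    exact Finset.sum_congr rfl fun π hπ => (key π hπ).map_add v w
  · intro c v
    simp only [pfaffian, Finset.smul_sum]
    exact Finset.sum_congr rfl fun π hπ => (key π hπ).map_smul c v

end skewBorder

/-- Bordering a skew-symmetric matrix by one of its own columns repeats a row. -/
theorem pfaffian_skewBorder_col {N : ℕ} {B : Matrix (Fin N) (Fin N) ℝ}
    (hB : ∀ i j, B j i = -B i j) (k : Fin N) : pfaffian (skewBorder B fun i => B i k) = 0 := by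
  refine pfaffian_eq_zero_of_row_eq (skewBorder_skew hB _) (Fin.castSucc_ne_last k) fun i => ?_
  induction i using Fin.lastCases with
  | last => simpa using self_eq_neg.1 (hB k k)
  | cast i => simpa using hB i k

section addArc

variable {m : ℕ}

/-- The permutation of `Fin (m + 2)` that acts as `π` on the first `m` points and exchanges the last
two: for a matching `π`, the matching with one more arc, on the right of all others. -/
def addArc (π : Equiv.Perm (Fin m)) : Equiv.Perm (Fin (m + 2)) :=
  finSumFinEquiv.permCongr (Equiv.sumCongr π (Equiv.swap (0 : Fin 2) 1))

@[simp]
theorem addArc_castSucc_castSucc (π : Equiv.Perm (Fin m)) (i : Fin m) :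
    addArc π i.castSucc.castSucc = (π i).castSucc.castSucc := by
  have : i.castSucc.castSucc = finSumFinEquiv (Sum.inl i : Fin m ⊕ Fin 2) := by ext; simp
  rw [addArc, Equiv.permCongr_apply, this, Equiv.symm_apply_apply]
  ext
  simp

@[simp]
theorem addArc_castSucc_last (π : Equiv.Perm (Fin m)) :
    addArc π (Fin.last m).castSucc = Fin.last (m + 1) := by
  have : (Fin.last m).castSucc = finSumFinEquiv (Sum.inr 0 : Fin m ⊕ Fin 2) := by ext; simp
  rw [addArc, Equiv.permCongr_apply, this, Equiv.symm_apply_apply]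
  ext
  simp

@[simp]
theorem addArc_last (π : Equiv.Perm (Fin m)) :
    addArc π (Fin.last (m + 1)) = (Fin.last m).castSucc := by
  have : Fin.last (m + 1) = finSumFinEquiv (Sum.inr 1 : Fin m ⊕ Fin 2) := by ext; simp
  rw [addArc, Equiv.permCongr_apply, this, Equiv.symm_apply_apply]
  ext
  simp

theorem addArc_injective : Function.Injective (addArc (m := m)) := by
  intro π τ h
  ext i
  have := congrArg (fun σ => ((σ i.castSucc.castSucc : Fin (m + 2)) : ℕ)) h
  simpa using this

theorem addArc_mem_perfectMatchings {π : Equiv.Perm (Fin m)} :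
    addArc π ∈ perfectMatchings (Fin (m + 2)) ↔ π ∈ perfectMatchings (Fin m) := by
  simp only [mem_perfectMatchings, Fin.forall_fin_succ', addArc_castSucc_castSucc,
    addArc_castSucc_last, addArc_last]
  simp [Fin.ext_iff]

theorem exists_addArc_eq {σ : Equiv.Perm (Fin (m + 2))}
    (hσ : σ ∈ perfectMatchings (Fin (m + 2)))
    (h : σ (Fin.last (m + 1)) = (Fin.last m).castSucc) : ∃ π, addArc π = σ := by
  rw [mem_perfectMatchings] at hσ
  have h' : σ (Fin.last m).castSucc = Fin.last (m + 1) := by rw [← h]; exact (hσ _).2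
  have key : ∀ i : Fin m, ∃ j : Fin m, j.castSucc.castSucc = σ i.castSucc.castSucc := by
    intro i
    have h₁ : σ i.castSucc.castSucc ≠ Fin.last (m + 1) := fun e =>
      absurd (σ.injective (e.trans h'.symm)) (by simp [Fin.ext_iff, i.isLt.ne])
    obtain ⟨y, hy⟩ := Fin.exists_castSucc_eq.2 h₁
    have h₂ : y ≠ Fin.last m := by
      rintro rfl
      exact absurd (σ.injective (hy.symm.trans h.symm)) (by simp [Fin.ext_iff]; omega)
    obtain ⟨z, rfl⟩ := Fin.exists_castSucc_eq.2 h₂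
    exact ⟨z, hy⟩
  choose f hf using key
  have hff : ∀ i, f (f i) = i := fun i => by
    have : (f (f i)).castSucc.castSucc = i.castSucc.castSucc := by rw [hf, hf]; exact (hσ _).2
    simpa using this
  refine ⟨⟨f, f, hff, hff⟩, Equiv.ext fun i => ?_⟩
  induction i using Fin.lastCases with
  | last => simp [h]
  | cast i =>
    induction i using Fin.lastCases with
    | last => simp [h']
    | cast i => rw [addArc_castSucc_castSucc]; exact hf i

theorem crossingNumber_addArc (π : Equiv.Perm (Fin m)) :
    crossingNumber (addArc π) = crossingNumber π := by
  rw [crossingNumber, crossingNumber]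
  symm
  refine Finset.card_bij (fun p _ => (p.1.castSucc.castSucc, p.2.castSucc.castSucc)) ?_ ?_ ?_
  · intro p hp
    rw [Finset.mem_filter_univ] at hp ⊢
    simpa using hp
  · rintro ⟨x, y⟩ _ ⟨z, w⟩ _ h
    simpa using h
  · rintro ⟨x, y⟩ hp
    rw [Finset.mem_filter_univ] at hp
    induction x using Fin.lastCases with
    | last => exact absurd hp.1 (Fin.le_last _).not_gt
    | cast x =>
    induction y using Fin.lastCases with
    | last => exact absurd hp.2.1 (Fin.le_last _).not_gt
    | cast y =>
    induction x using Fin.lastCases with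
    | last => exact absurd hp.1 (by simpa using Fin.le_last _)
    | cast x =>
    induction y using Fin.lastCases with
    | last =>
      have := hp.2.1
      simp at this
      exact absurd this (Fin.le_last _).not_gt
    | cast y =>
    refine ⟨(x, y), ?_, rfl⟩
    rw [Finset.mem_filter_univ]
    simpa using hp

theorem pfaffian_skewBorder_single {R : Type*} [CommRing R]
    (B : Matrix (Fin (m + 1)) (Fin (m + 1)) R) (h : R) :
    pfaffian (skewBorder B (Pi.single (Fin.last m) h)) =
      h * pfaffian (B.submatrix Fin.castSucc Fin.castSucc) := by
  rw [pfaffian, pfaffian, Finset.mul_sum]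
  symm
  refine Finset.sum_of_injOn addArc addArc_injective.injOn ?_ ?_ ?_
  · intro π hπ
    exact addArc_mem_perfectMatchings.2 hπ
  · intro σ hσ hn
    have hσ' := mem_perfectMatchings.1 hσ
    obtain ⟨k, hk⟩ := Fin.exists_castSucc_eq.2 (hσ' (Fin.last (m + 1))).1
    have hk' : σ k.castSucc = Fin.last (m + 1) := by rw [hk]; exact (hσ' _).2
    have hkl : k ≠ Fin.last m := by
      rintro rfl
      obtain ⟨π, rfl⟩ := exists_addArc_eq hσ hk.symm
      exact hn ⟨π, addArc_mem_perfectMatchings.1 hσ, rfl⟩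
    rw [Finset.prod_eq_zero (i := k.castSucc), mul_zero]
    · simp [hk', Fin.castSucc_lt_last]
    · rw [hk', skewBorder_castSucc_last, Pi.single_eq_of_ne hkl]
  · intro π _
    rw [crossingNumber_addArc, Finset.prod_filter, Finset.prod_filter]
    simp only [Fin.prod_univ_castSucc, addArc_castSucc_castSucc, addArc_castSucc_last, addArc_last]
    simp [Fin.castSucc_lt_last, (Fin.castSucc_lt_last _).not_gt]
    ring

end addArc

/-- Reduction of the Pfaffian by one step of skew-symmetric elimination: if adding a combination of
the other columns to the last one leaves only the entry `h` above its last place, there in row `m`,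
then the Pfaffian is `h` times that of the leading `m × m` block. -/
theorem pfaffian_eq_mul_of_sum_col_eq {m : ℕ} {A : Matrix (Fin (m + 2)) (Fin (m + 2)) ℝ}
    (hA : ∀ i j, A j i = -A i j) (c : Fin (m + 1) → ℝ) (h : ℝ)
    (hc : ∀ i : Fin (m + 1), ∑ j, c j * A i.castSucc j.castSucc + A i.castSucc (Fin.last (m + 1)) =
      if i = Fin.last m then h else 0) :
    pfaffian A =
      h * pfaffian (A.submatrix (fun i : Fin m => i.castSucc.castSucc)
        (fun i : Fin m => i.castSucc.castSucc)) := by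
  set B := A.submatrix (Fin.castSucc (n := m + 1)) (Fin.castSucc (n := m + 1)) with hB
  have hBs : ∀ i j, B j i = -B i j := fun i j => hA _ _
  have hAB : A = skewBorder B fun i => A i.castSucc (Fin.last (m + 1)) := by
    ext i j
    induction i using Fin.lastCases <;> induction j using Fin.lastCases <;> simp [hB]
    · exact self_eq_neg.1 (hA _ _)
    · exact hA _ _
  let L := (isLinearMap_pfaffian_skewBorder B).mk'
  have hv : (Pi.single (Fin.last m) h : Fin (m + 1) → ℝ) =
      ∑ j, c j • (fun i => B i j) + fun i => A i.castSucc (Fin.last (m + 1)) := by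
    ext i
    simpa [Pi.single_apply, hB] using (hc i).symm
  have h₁ : L (Pi.single (Fin.last m) h) = L fun i => A i.castSucc (Fin.last (m + 1)) := by
    rw [hv, map_add, map_sum, Finset.sum_eq_zero, zero_add]
    intro j _
    rw [map_smul]
    exact smul_eq_zero_of_right _ (pfaffian_skewBorder_col hBs j)
  rw [hAB]
  refine h₁.symm.trans ((pfaffian_skewBorder_single B h).trans ?_)
  rw [← hAB]
  rfl

/-! ### Skew-orthogonality of the Laguerre polynomials -/

theorem Gamma_add_natCast_eq_ascPochhammer {x : ℝ} (k : ℕ) (hx : ∀ m : ℕ, x ≠ -(m : ℝ)) :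
    Real.Gamma (x + k) = (ascPochhammer ℝ k).eval x * Real.Gamma x := by
  induction k with
  | zero => simp
  | succ k ih =>
    have : x + k ≠ 0 := fun h => hx k (by linarith)
    rw [Nat.cast_succ, ← add_assoc, Real.Gamma_add_one this, ih, ascPochhammer_succ_eval]
    ring

/-- Both sides are `(j - i)` times `(b + j)_{N-j} (b + j)_i Γ(b + j)`. The only exceptional case is
`b = j = 0`, where `Γ(b + j)` has a pole; then a Pochhammer symbol vanishes on each side, or
`i = j`. -/
theorem ascPochhammer_mul_sub_mul_Gamma {b : ℝ} (hb : ∀ m : ℕ, b ≠ -((m : ℝ) + 1)) {i j N : ℕ}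
    (hjN : j ≤ N) (hN : N ≠ 0) :
    (ascPochhammer ℝ (N - j)).eval (b + j) * (((j : ℝ) - i) * Real.Gamma (b + i + j)) =
      Real.Gamma (b + N) * (((j : ℝ) - i) * (ascPochhammer ℝ i).eval (b + j)) := by
  by_cases h : ∀ m : ℕ, b + j ≠ -(m : ℝ)
  · have h₁ := Gamma_add_natCast_eq_ascPochhammer i h
    have h₂ := Gamma_add_natCast_eq_ascPochhammer (N - j) h
    rw [Nat.cast_sub hjN, show b + j + ((N : ℝ) - j) = b + N by ring] at h₂
    rw [show b + i + j = b + j + i by ring, h₁, h₂]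
    ring
  · push Not at h
    obtain ⟨m, hm⟩ := h
    have hmj : m + j = 0 := by
      by_contra hne
      obtain ⟨k, hk⟩ := Nat.exists_eq_succ_of_ne_zero hne
      apply hb k
      have : (m : ℝ) + j = k + 1 := by exact_mod_cast hk
      linarith
    obtain ⟨rfl, rfl⟩ : m = 0 ∧ j = 0 := by omega
    have hb0 : b = 0 := by simpa using hm
    subst hb0
    rcases eq_or_ne i 0 with rfl | hi
    · simp
    · simp [ascPochhammer_ne_zero_eval_zero, hN, hi]

/-- The sum is the `N`-th forward difference at `0` of the monic polynomial `(X - i) (X + b)_i`, of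
degree `i + 1`. -/
theorem sum_alternating_choose_mul_ascPochhammer (b : ℝ) {i N : ℕ} (hi : i < N) :
    ∑ j ∈ Finset.range (N + 1), (-1 : ℝ) ^ (N - j) * (N.choose j : ℝ) *
      (((j : ℝ) - i) * (ascPochhammer ℝ i).eval (b + j)) =
      if i + 1 = N then (N.factorial : ℝ) else 0 := by
  set q : Polynomial ℝ := (ascPochhammer ℝ i).comp (Polynomial.X + Polynomial.C b) with hq
  set P : Polynomial ℝ := (Polynomial.X - Polynomial.C (i : ℝ)) * q with hP
  have hqm : q.Monic := (monic_ascPochhammer ℝ i).comp_X_add_C b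
  have hPm : P.Monic := (Polynomial.monic_X_sub_C _).mul hqm
  have hPd : P.natDegree = i + 1 := by
    rw [hP, (Polynomial.monic_X_sub_C _).natDegree_mul hqm, hq, Polynomial.natDegree_comp,
      Polynomial.natDegree_X_sub_C]
    simp [add_comm]
  have hsum := fwdDiff_iter_eq_sum_shift (1 : ℝ) P.eval N 0
  have hval : (fwdDiff (1 : ℝ))^[N] P.eval 0 = if i + 1 = N then (N.factorial : ℝ) else 0 := by
    split_ifs with h
    · have := P.fwdDiff_iter_degree_eq_factorial
      rw [hPd, h, hPm.leadingCoeff] at this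
      simp [this]
    · rw [Polynomial.fwdDiff_iter_eq_zero_of_degree_lt (by omega)]
      rfl
  rw [← hval, hsum]
  refine Finset.sum_congr rfl fun j _ => ?_
  simp [hP, hq, add_comm b]

/-- Skew-orthogonality of the monic Laguerre polynomial of degree `N` and parameter `b - 1`, whose
coefficients are `(-1)^(N-j) (N choose j) (b + j)_{N-j}`, to the monomials of degree `i < N - 1`, and
its value against the monomial of degree `N - 1`. -/
theorem sum_monicLaguerre_mul_Gamma {b : ℝ} (hb : ∀ m : ℕ, b ≠ -((m : ℝ) + 1)) {i N : ℕ}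
    (hi : i < N) :
    ∑ j ∈ Finset.range (N + 1), (-1 : ℝ) ^ (N - j) * (N.choose j : ℝ) *
      (ascPochhammer ℝ (N - j)).eval (b + j) * (((j : ℝ) - i) * Real.Gamma (b + i + j)) =
      if i + 1 = N then (N.factorial : ℝ) * Real.Gamma (b + N) else 0 := by
  have : ∀ j ∈ Finset.range (N + 1), (-1 : ℝ) ^ (N - j) * (N.choose j : ℝ) *
      (ascPochhammer ℝ (N - j)).eval (b + j) * (((j : ℝ) - i) * Real.Gamma (b + i + j)) =
      Real.Gamma (b + N) * ((-1 : ℝ) ^ (N - j) * (N.choose j : ℝ) *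
      (((j : ℝ) - i) * (ascPochhammer ℝ i).eval (b + j))) := by
    intro j hj
    rw [mul_assoc, ascPochhammer_mul_sub_mul_Gamma hb (Finset.mem_range_succ_iff.1 hj) (by omega)]
    ring
  rw [Finset.sum_congr rfl this, ← Finset.mul_sum, sum_alternating_choose_mul_ascPochhammer b hi]
  split_ifs <;> ring

/-! ### The evaluation -/

theorem pfaffian_sub_mul_Gamma {b : ℝ} (hb : ∀ k : ℕ, b ≠ -((k : ℝ) + 1)) (m : ℕ) :
    pfaffian (Matrix.of fun i j : Fin (2 * m) =>
        (((j : ℕ) : ℝ) - ((i : ℕ) : ℝ)) * Real.Gamma (b + (i : ℕ) + (j : ℕ))) =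
      ∏ i ∈ Finset.range m,
        ((Nat.factorial (2 * i + 1) : ℕ) : ℝ) * Real.Gamma (b + 2 * (i : ℝ) + 1) := by
  induction m with
  | zero => simp [pfaffian, perfectMatchings, crossingNumber]
  | succ m ih =>
    rw [Finset.prod_range_succ, ← ih, mul_comm (pfaffian _)]
    refine pfaffian_eq_mul_of_sum_col_eq (m := 2 * m) ?_
      (fun j => (-1 : ℝ) ^ (2 * m + 1 - j) * ((2 * m + 1).choose j : ℝ) *
        (ascPochhammer ℝ (2 * m + 1 - j)).eval (b + (j : ℕ))) _ ?_
    · intro i j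
      simp only [Matrix.of_apply]
      rw [show b + (j : ℕ) + (i : ℕ) = b + (i : ℕ) + (j : ℕ) by ring]
      ring
    · intro i
      have h := sum_monicLaguerre_mul_Gamma hb i.isLt
      rw [Finset.sum_range_succ, Finset.sum_range] at h
      simp only [Matrix.of_apply, Fin.val_castSucc, Fin.val_last, Fin.ext_iff]
      simp only [Nat.sub_self, pow_zero, Nat.choose_self, Nat.cast_one, ascPochhammer_zero,
        Polynomial.eval_one, one_mul] at h
      rw [h]
      simp only [Nat.add_right_cancel_iff]
      push_cast
      rw [show b + (2 * (m : ℝ) + 1) = b + 2 * m + 1 by ring]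

theorem proposition9 (b : ℝ) (n : ℕ) (hn : 0 < n) (hn_even : Even n)
    (hb : ∀ i j : Fin n, i < j → ∀ m : ℕ, b + (i : ℕ) + (j : ℕ) ≠ -(m : ℝ)) :
    pfaffian (Matrix.of fun i j : Fin n =>
        (((j : ℕ) : ℝ) - ((i : ℕ) : ℝ)) * Real.Gamma (b + (i : ℕ) + (j : ℕ))) =
      ∏ i ∈ Finset.range (n / 2),
        ((Nat.factorial (2 * i + 1) : ℕ) : ℝ) * Real.Gamma (b + 2 * (i : ℝ) + 1) := by
  have hb' : ∀ k : ℕ, b ≠ -((k : ℝ) + 1) := by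
    intro k hk
    have hn2 : 1 < n := by
      obtain ⟨r, rfl⟩ := hn_even
      omega
    refine hb ⟨0, hn⟩ ⟨1, hn2⟩ (by simp) k ?_
    simp only [Nat.cast_zero, Nat.cast_one]
    linarith
  obtain ⟨m, rfl⟩ := hn_even.two_dvd
  rw [Nat.mul_div_cancel_left m two_pos]
  exact pfaffian_sub_mul_Gamma hb' m
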